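/- Let $R$ be an associative ring with unit; "module" means left $R$-module. A module $F$ is \emph{super finitely presented} if there is an exact sequence $\cdots\to F_1\to F_0\to F\to 0$ with all $F_i$ finitely generated projective. A module $W$ is \emph{weak injective} if $\operatorname{Ext}^1_R(F,W)=0$ for every super finitely presented $F$, and its weak injective dimension $wid_R(W)\in\{0,1,2,\dots,\infty\}$ is the least $n\ge 0$ such that $\operatorname{Ext}^{n+1}_R(F,W)=0$ for every super finitely presented $F$ ($\infty$ if there is no such $n$). A module $M$ is \emph{Gorenstein weak injective} if there is an exact sequence of injective modules $\cdots\to I_1\to I_0\to I^0\to I^1\to\cdots$ with $M\cong\operatorname{Coker}(I_1\to I_0)$ that remains exact under $\operatorname{Hom}_R(W,-)$ for every weak injective $W$; the class of these modules is $\mathcal{GWI}$. The Gorenstein weak injective dimension $Gwid_R(M)$ is the least $n\geq 0$ for which there is an exact sequence $0\to M\to G^0\to\cdots\to G^n\to 0$ with all $G^i\in\mathcal{GWI}$ ($\infty$ if there is none), and $\ell.GwiD(R)=\sup_M Gwid_R(M)$, where $M$ runs over all modules. A \emph{proper right $\mathcal{GWI}$-resolution} of $N$ is a complex $0\to N\to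 G^0\to G^1\to\cdots$ with all $G^i\in\mathcal{GWI}$ that becomes exact under $\operatorname{Hom}_R(-,G)$ for every $G\in\mathcal{GWI}$. For such a resolution, $\operatorname{Ext}^i_{\mathcal{GWI}}(M,N)$ is the $i$-th cohomology group of the complex $0\to\operatorname{Hom}_R(M,G^0)\to\operatorname{Hom}_R(M,G^1)\to\cdots$. Proposition. Assume $\ell.GwiD(R)<\infty$. Then every module has a proper right $\mathcal{GWI}$-resolution. Moreover, for every module $N$, every proper right $\mathcal{GWI}$-resolution of $N$ used to compute $\operatorname{Ext}_{\mathcal{GWI}}(-,N)$, and every integer $n\geq 0$, the following are equivalent: (1) $Gwid_R(N)\leq n$; (2) $\operatorname{Ext}^i_R(W,N)=0$ for every weak injective module $W$ and every $i\geq n+1$; (3) $\operatorname{Ext}^i_R(\widetilde W,N)=0$ for every module $\widetilde W$ with $wid_R(\widetilde W)<\infty$ and every $i\geq n+1$; (4) for every exact sequence $0\to N\to I^0\to\cdots\to I^{n-1}\to C^n\to 0$ with all $I^i$ injective, $C^n$ is Gorenstein weak injective; (5) for every exact sequence $0\to N\to G^0\to\cdots\to G^{n-1}\to V^n\to 0$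 with all $G^i$ Gorenstein weak injective, $V^n$ is Gorenstein weak injective; (6) $\operatorname{Ext}^{n+1}_{\mathcal{GWI}}(M,N)=0$ for every module $M$; (7) $\operatorname{Ext}^i_{\mathcal{GWI}}(M,N)=0$ for every module $M$ and every $i\geq n+1$. -/

import Mathlib

open CategoryTheory CategoryTheory.Limits

universe u

namespace GorensteinWeak

section

variable {R : Type u} [Ring R]

/-- `N` is super finitely presented: it has a resolution
`⋯ ⟶ F₁ ⟶ F₀ ⟶ N ⟶ 0` by finitely generated projective modules. -/
def IsSuperFinitelyPresented (N : ModuleCat.{u} R) : Prop :=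
  ∃ F : ProjectiveResolution N, ∀ i, Module.Finite R (F.complex.X i)

/-- `M` is weak injective: `Ext¹(N, M) = 0` for all super finitely presented `N`. -/
def IsWeakInjective (M : ModuleCat.{u} R) : Prop :=
  ∀ N : ModuleCat.{u} R, IsSuperFinitelyPresented N → Subsingleton (Abelian.Ext N M 1)

/-- The weak injective dimension: the least `n` such that `Extⁿ⁺¹(N, M) = 0` for all super finitely
presented `N`, and `⊤` if there is none. -/
noncomputable def wid (M : ModuleCat.{u} R) : ℕ∞ :=
  sInf {k : ℕ∞ | ∃ n : ℕ, k = n ∧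
    ∀ N : ModuleCat.{u} R, IsSuperFinitelyPresented N → Subsingleton (Abelian.Ext N M (n + 1))}

/-- The complex of abelian groups `Hom(M, K)`. -/
noncomputable abbrev homComplex {ι : Type} {c : ComplexShape ι} (M : ModuleCat.{u} R)
    (K : HomologicalComplex (ModuleCat.{u} R) c) : HomologicalComplex AddCommGrpCat.{u} c :=
  ((preadditiveCoyoneda.obj (Opposite.op M)).mapHomologicalComplex c).obj K

/-- `M` is Gorenstein weak injective: `M ≅ Coker (I₁ ⟶ I₀)` for an exact sequence
`⋯ ⟶ I₁ ⟶ I₀ ⟶ I⁰ ⟶ I¹ ⟶ ⋯` of injective modules that stays exact under `Hom(W, -)` for every weak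
injective `W`. Here `Iʲ` sits in degree `j` and `I_j` in degree `-1 - j`. -/
def IsGorensteinWeakInjective (M : ModuleCat.{u} R) : Prop :=
  ∃ I : CochainComplex (ModuleCat.{u} R) ℤ,
    (∀ i, Injective (I.X i)) ∧ I.Acyclic ∧
    (∀ W : ModuleCat.{u} R, IsWeakInjective W → (homComplex W I).Acyclic) ∧
    Nonempty (M ≅ cokernel (I.d (-2) (-1)))

/-- A complex `0 ⟶ M ⟶ X⁰ ⟶ X¹ ⟶ ⋯`. -/
structure CoaugmentedComplex (M : ModuleCat.{u} R) where
  /-- the complex `0 ⟶ X⁰ ⟶ X¹ ⟶ ⋯`, without `M` -/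
  cocomplex : CochainComplex (ModuleCat.{u} R) ℕ
  /-- the coaugmentation `M ⟶ X⁰` -/
  ι : M ⟶ cocomplex.X 0
  ι_comp_d : ι ≫ cocomplex.d 0 1 = 0

namespace CoaugmentedComplex

variable {M : ModuleCat.{u} R} (C : CoaugmentedComplex M)

/-- `0 ⟶ M ⟶ X⁰ ⟶ X¹ ⟶ ⋯` is exact. -/
def IsExact : Prop :=
  Mono C.ι ∧ (ShortComplex.mk C.ι (C.cocomplex.d 0 1) C.ι_comp_d).Exact ∧
    ∀ i : ℕ, C.cocomplex.ExactAt (i + 1)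

/-- `⋯ ⟶ Hom(X¹, G) ⟶ Hom(X⁰, G) ⟶ Hom(M, G) ⟶ 0` is exact. -/
def IsHomExact (G : ModuleCat.{u} R) : Prop :=
  (∀ f : M ⟶ G, ∃ g : C.cocomplex.X 0 ⟶ G, C.ι ≫ g = f) ∧
  (∀ f : C.cocomplex.X 0 ⟶ G, C.ι ≫ f = 0 →
    ∃ g : C.cocomplex.X 1 ⟶ G, C.cocomplex.d 0 1 ≫ g = f) ∧
  (∀ (i : ℕ) (f : C.cocomplex.X (i + 1) ⟶ G), C.cocomplex.d i (i + 1) ≫ f = 0 →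
    ∃ g : C.cocomplex.X (i + 2) ⟶ G, C.cocomplex.d (i + 1) (i + 2) ≫ g = f)

/-- The complex is an exact sequence `0 ⟶ M ⟶ X⁰ ⟶ ⋯ ⟶ Xⁿ ⟶ 0`
(for `n = 0` this says that `M ⟶ X⁰` is an isomorphism). -/
def IsExactOfLength (n : ℕ) : Prop :=
  C.IsExact ∧ ∀ i : ℕ, n < i → IsZero (C.cocomplex.X i)

end CoaugmentedComplex

/-- The Gorenstein weak injective dimension: the least `n` for which there is an exact sequence
`0 ⟶ M ⟶ G⁰ ⟶ ⋯ ⟶ Gⁿ ⟶ 0` with all `Gⁱ` Gorenstein weak injective, `⊤` if there is none. -/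
noncomputable def Gwid (M : ModuleCat.{u} R) : ℕ∞ :=
  sInf {k : ℕ∞ | ∃ n : ℕ, k = n ∧ ∃ C : CoaugmentedComplex M, C.IsExactOfLength n ∧
    ∀ i ≤ n, IsGorensteinWeakInjective (C.cocomplex.X i)}

variable (R) in
/-- The left global Gorenstein weak injective dimension of `R`. -/
noncomputable def leftGwiD : ℕ∞ := ⨆ M : ModuleCat.{u} R, Gwid M

/-- A proper right resolution `0 ⟶ N ⟶ G⁰ ⟶ G¹ ⟶ ⋯` of `N` by Gorenstein weak injective modules:
it is exact under `Hom(-, G)` for every Gorenstein weak injective `G`. -/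
structure ProperRightGWIResolution (N : ModuleCat.{u} R) extends CoaugmentedComplex N where
  gorensteinWeakInjective : ∀ i, IsGorensteinWeakInjective (cocomplex.X i)
  isHomExact : ∀ G : ModuleCat.{u} R, IsGorensteinWeakInjective G →
    toCoaugmentedComplex.IsHomExact G

/-- The relative right derived functor `Extⁱ_GWI(M, N) = Hⁱ(Hom(M, G•))`, computed from a proper
right resolution `0 ⟶ N ⟶ G⁰ ⟶ G¹ ⟶ ⋯`. -/
noncomputable def ExtGWI (M : ModuleCat.{u} R) {N : ModuleCat.{u} R}
    (G : ProperRightGWIResolution N) (i : ℕ) : AddCommGrpCat.{u} :=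
  (homComplex M G.cocomplex).homology i

end

end GorensteinWeak

/-! The crux: when `leftGwiD R` is finite, the Gorenstein weak injective modules are exactly the
modules X with Extⁱ(W, X) = 0 for all weak injective W and i ≥ 1. One inclusion always holds, by
dimension shifting in the defining complex. For the converse, every module M embeds in a Gorenstein
weak injective G whose cokernel A is finitely coresolved by weak injectives; this follows by
descending induction along a finite Gorenstein weak injective coresolution of M
(`HasGWIApproximation.X₁`). If X is orthogonal, then Ext¹(A, X) = 0, so X is a summand of its G, and
an epimorphism from an injective onto G induces one onto X whose kernel is again orthogonal.
Iterating builds the left half of a complete resolution, and any injective resolution supplies the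
right half (`isGorensteinWeakInjective_of_coinduction`).

Dimension shifting then identifies (2) with the n-th cosyzygy of a Gorenstein weak injective
coresolution being Gorenstein weak injective, which yields (1)–(5). Iterated approximations form
proper resolutions. These are exact because injectives are Gorenstein weak injective, and
Extⁿ⁺¹_GWI(-, N) vanishes exactly when the inclusion of the n-th cosyzygy into Gⁿ splits, which
brings in (6) and (7). -/

namespace GorensteinWeak

/-! ### Vanishing, lifting and extension from the long exact sequences of Ext. -/

section ExtVanishing

universe w v

variable {C : Type u} [Category.{v} C] [Abelian C] [HasExt.{w} C]

open Abelian

lemma subsingleton_ext_of_retract {T M N : C} (i : M ⟶ N) (r : N ⟶ M) (h : i ≫ r = 𝟙 M) (n : ℕ)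
    [Subsingleton (Ext T N n)] : Subsingleton (Ext T M n) := by
  refine subsingleton_of_forall_eq 0 fun x => ?_
  have hx : x = (x.comp (Ext.mk₀ i) (add_zero n)).comp (Ext.mk₀ r) (add_zero n) := by
    simp [h]
  rw [hx, Subsingleton.elim (x.comp (Ext.mk₀ i) (add_zero n)) 0, Ext.zero_comp]

variable {S : ShortComplex C} (hS : S.ShortExact)
include hS

lemma subsingleton_ext_X₁ (T : C) (n : ℕ) (h₂ : Subsingleton (Ext T S.X₂ (n + 1)))
    (h₃ : Subsingleton (Ext T S.X₃ n)) : Subsingleton (Ext T S.X₁ (n + 1)) := by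
  refine subsingleton_of_forall_eq 0 fun x => ?_
  obtain ⟨y, rfl⟩ := Ext.covariant_sequence_exact₁ T hS x (Subsingleton.elim _ _) rfl
  rw [Subsingleton.elim y 0, Ext.zero_comp]

lemma subsingleton_ext_X₂ (T : C) (n : ℕ) (h₁ : Subsingleton (Ext T S.X₁ n))
    (h₃ : Subsingleton (Ext T S.X₃ n)) : Subsingleton (Ext T S.X₂ n) := by
  refine subsingleton_of_forall_eq 0 fun x => ?_
  obtain ⟨y, rfl⟩ := Ext.covariant_sequence_exact₂ T hS x (Subsingleton.elim _ _)
  rw [Subsingleton.elim y 0, Ext.zero_comp]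

lemma subsingleton_ext_X₃ (T : C) (n : ℕ) (h₁ : Subsingleton (Ext T S.X₁ (n + 1)))
    (h₂ : Subsingleton (Ext T S.X₂ n)) : Subsingleton (Ext T S.X₃ n) := by
  refine subsingleton_of_forall_eq 0 fun x => ?_
  obtain ⟨y, rfl⟩ := Ext.covariant_sequence_exact₃ T hS x rfl (Subsingleton.elim _ _)
  rw [Subsingleton.elim y 0, Ext.zero_comp]

lemma subsingleton_ext_X₁_left (Y : C) (n : ℕ) (h₂ : Subsingleton (Ext S.X₂ Y n))
    (h₃ : Subsingleton (Ext S.X₃ Y (n + 1))) : Subsingleton (Ext S.X₁ Y n) := by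
  refine subsingleton_of_forall_eq 0 fun x => ?_
  obtain ⟨y, rfl⟩ := Ext.contravariant_sequence_exact₁ hS Y x (add_comm 1 n)
    (Subsingleton.elim _ _)
  rw [Subsingleton.elim y 0, Ext.comp_zero]

/-- Morphisms `T ⟶ S.X₃` lift to `S.X₂` if `Ext¹(T, S.X₁) = 0`. -/
lemma exists_lift_of_subsingleton_ext {T : C} (h : Subsingleton (Ext T S.X₁ 1)) (f : T ⟶ S.X₃) :
    ∃ f' : T ⟶ S.X₂, f' ≫ S.g = f := by
  obtain ⟨y, hy⟩ := Ext.covariant_sequence_exact₃ T hS (Ext.mk₀ f) (zero_add 1)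
    (Subsingleton.elim _ _)
  obtain ⟨f', rfl⟩ := (Ext.mk₀_bijective _ _).surjective y
  exact ⟨f', (Ext.mk₀_bijective _ _).injective (by simpa using hy)⟩

/-- Morphisms `S.X₁ ⟶ Y` extend to `S.X₂` if `Ext¹(S.X₃, Y) = 0`. -/
lemma exists_extension_of_subsingleton_ext {Y : C} (h : Subsingleton (Ext S.X₃ Y 1))
    (f : S.X₁ ⟶ Y) : ∃ f' : S.X₂ ⟶ Y, S.f ≫ f' = f := by
  obtain ⟨y, hy⟩ := Ext.contravariant_sequence_exact₁ hS Y (Ext.mk₀ f) (add_zero 1)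
    (Subsingleton.elim _ _)
  obtain ⟨f', rfl⟩ := (Ext.mk₀_bijective _ _).surjective y
  exact ⟨f', (Ext.mk₀_bijective _ _).injective (by simpa using hy)⟩

/-- Every class in Ext¹(T, X₁) is the connecting image of some T ⟶ X₃, and the connecting map kills
morphisms that lift to X₂. -/
lemma subsingleton_ext_one_of_exists_lift {T : C} (h₂ : Subsingleton (Ext T S.X₂ 1))
    (h : ∀ f : T ⟶ S.X₃, ∃ f' : T ⟶ S.X₂, f' ≫ S.g = f) : Subsingleton (Ext T S.X₁ 1) := by
  refine subsingleton_of_forall_eq 0 fun x => ?_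
  obtain ⟨y, rfl⟩ := Ext.covariant_sequence_exact₁ T hS x (Subsingleton.elim _ _) (zero_add 1)
  obtain ⟨f, rfl⟩ := (Ext.mk₀_bijective _ _).surjective y
  obtain ⟨f', rfl⟩ := h f
  rw [← Ext.mk₀_comp_mk₀, Ext.comp_assoc (a₂₃ := 1) (h₁₂ := zero_add 0) (h₂₃ := zero_add 1)
    (h := by simp), hS.comp_extClass, Ext.comp_zero]

end ExtVanishing

/-! ### Pullback and horseshoe short exact sequences. -/

section ShortExact

universe v

variable {C : Type u} [Category.{v} C] [Abelian C]

lemma shortExact_kernel {X Y : C} (p : X ⟶ Y) [Epi p] :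
    (ShortComplex.mk (kernel.ι p) p (kernel.condition p)).ShortExact where
  exact := ShortComplex.exact_kernel p

lemma shortExact_cokernel {X Y : C} (i : X ⟶ Y) [Mono i] :
    (ShortComplex.mk i (cokernel.π i) (cokernel.condition i)).ShortExact where
  exact := ShortComplex.exact_cokernel i

variable {S : ShortComplex C} (hS : S.ShortExact)
include hS

lemma shortExact_comp_iso_left {X : C} (e : X ≅ S.X₁) :
    (ShortComplex.mk (e.hom ≫ S.f) S.g (by simp)).ShortExact :=
  ShortComplex.shortExact_of_iso
    (ShortComplex.isoMk e.symm (Iso.refl _) (Iso.refl _) (by simp) (by simp)) hS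

/-- The short exact sequence `0 ⟶ X₁ ⟶ X₂ ×_{X₃} L ⟶ L ⟶ 0`. -/
lemma shortExact_pullback_snd {L : C} (h : L ⟶ S.X₃) :
    (ShortComplex.mk (pullback.lift S.f 0 (by simp)) (pullback.snd S.g h)
      (pullback.lift_snd _ _ _)).ShortExact := by
  have := hS.mono_f
  have := hS.epi_g
  have : Mono (pullback.lift S.f 0 (by simp) : S.X₁ ⟶ pullback S.g h) :=
    mono_of_mono_fac (pullback.lift_fst _ _ _)
  refine ⟨ShortComplex.exact_of_f_is_kernel _ (KernelFork.IsLimit.ofι' _ _ fun {A} k hk => ?_)⟩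
  dsimp at k hk
  have hk' : (k ≫ pullback.fst _ _) ≫ S.g = 0 := by
    rw [Category.assoc, pullback.condition, reassoc_of% hk, zero_comp]
  refine ⟨hS.exact.lift (k ≫ pullback.fst _ _) hk', ?_⟩
  apply pullback.hom_ext
  · rw [Category.assoc, pullback.lift_fst, ShortComplex.Exact.lift_f]
  · rw [Category.assoc, pullback.lift_snd, comp_zero, hk]

/-- The short exact sequence `0 ⟶ X₁ ⟶ L ×_{X₃} X₂ ⟶ L ⟶ 0`. -/
lemma shortExact_pullback_fst {L : C} (h : L ⟶ S.X₃) :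
    (ShortComplex.mk (pullback.lift 0 S.f (by simp)) (pullback.fst h S.g)
      (pullback.lift_fst _ _ _)).ShortExact := by
  refine ShortComplex.shortExact_of_iso ?_ (shortExact_pullback_snd hS h)
  exact ShortComplex.isoMk (Iso.refl _) (pullbackSymmetry S.g h) (Iso.refl _)
    (by dsimp; apply pullback.hom_ext <;> simp [pullback.lift_fst, pullback.lift_snd])
    (by dsimp; simp)

/-- The short exact sequence `0 ⟶ X₁ ×_{X₂} I ⟶ I ⟶ X₃ ⟶ 0` for an epimorphism `I ⟶ X₂`. -/
lemma shortExact_pullback_of_epi {I : C} (p : I ⟶ S.X₂) [Epi p] :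
    (ShortComplex.mk (pullback.snd S.f p) (p ≫ S.g)
      (by rw [← pullback.condition_assoc, S.zero, comp_zero])).ShortExact := by
  have := hS.mono_f
  have := hS.epi_g
  have : Epi (p ≫ S.g) := epi_comp _ _
  refine ⟨ShortComplex.exact_of_f_is_kernel _ (KernelFork.IsLimit.ofι' _ _ fun {A} k hk => ?_)⟩
  dsimp at k hk
  refine ⟨pullback.lift (hS.exact.lift (k ≫ p) (by simpa using hk)) k (by simp),
    pullback.lift_snd _ _ _⟩

variable {I J : C} (p : I ⟶ S.X₁) (q : J ⟶ S.X₂) [Epi p]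

/-- Correct an element of X₂ by an element of J with the same image in X₃; the difference lies in
X₁, where p reaches it. -/
lemma epi_biprod_desc [Epi (q ≫ S.g)] : Epi (biprod.desc (p ≫ S.f) q) := by
  rw [epi_iff_surjective_up_to_refinements]
  intro A y
  obtain ⟨A₁, π₁, _, j, hj⟩ := surjective_up_to_refinements_of_epi (q ≫ S.g) (y ≫ S.g)
  obtain ⟨x, hx⟩ : ∃ x : A₁ ⟶ S.X₁, x ≫ S.f = π₁ ≫ y - j ≫ q :=
    have := hS.mono_f
    ⟨hS.exact.lift _ (by simp [Preadditive.sub_comp, hj]), hS.exact.lift_f _ _⟩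
  obtain ⟨A₂, π₂, _, i, hi⟩ := surjective_up_to_refinements_of_epi p x
  refine ⟨A₂, π₂ ≫ π₁, epi_comp _ _, biprod.lift i (π₂ ≫ j), ?_⟩
  simp only [Category.assoc, biprod.lift_desc]
  rw [← reassoc_of% hi, hx]
  simp [Preadditive.comp_sub]

/-- The short exact sequence of kernels in the horseshoe of `p : I ⟶ X₁` and `q : J ⟶ X₂`. -/
lemma shortExact_kernel_biprod_desc :
    (ShortComplex.mk
      (kernel.lift (biprod.desc (p ≫ S.f) q) (kernel.ι p ≫ biprod.inl) (by simp))
      (kernel.lift (q ≫ S.g) (kernel.ι (biprod.desc (p ≫ S.f) q) ≫ biprod.snd) (by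
        have h := kernel.condition (biprod.desc (p ≫ S.f) q) =≫ S.g
        simpa [biprod.desc_eq] using h))
      (by ext; simp)).ShortExact := by
  have := hS.mono_f
  have hd : ∀ {A : C} (x : A ⟶ I ⊞ J), x ≫ biprod.desc (p ≫ S.f) q =
      (x ≫ biprod.fst ≫ p) ≫ S.f + x ≫ biprod.snd ≫ q := fun x => by
    rw [biprod.desc_eq, Preadditive.comp_add]; simp
  refine { exact := ?_, mono_f := ?_, epi_g := ?_ }
  · refine ShortComplex.exact_of_f_is_kernel _ (KernelFork.IsLimit.ofι' _ _ fun {A} k hk => ?_)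
    dsimp at k hk ⊢
    have hk' : k ≫ kernel.ι _ ≫ biprod.snd = 0 := by simpa using hk =≫ kernel.ι _
    have h : (k ≫ kernel.ι _) ≫ biprod.fst ≫ p = 0 := by
      have h := hd (k ≫ kernel.ι _)
      simpa [reassoc_of% hk', ← cancel_mono S.f] using h.symm
    refine ⟨kernel.lift p (k ≫ kernel.ι _ ≫ biprod.fst) (by simpa using h), ?_⟩
    ext
    · simp
    · simpa using hk'.symm
  · exact mono_of_mono_fac (kernel.lift_ι _ _ _)
  · rw [epi_iff_surjective_up_to_refinements]
    intro A y
    have hy : (y ≫ kernel.ι _ ≫ q) ≫ S.g = 0 := by simp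
    obtain ⟨A₁, π, _, i, hi⟩ := surjective_up_to_refinements_of_epi p (hS.exact.lift _ hy)
    refine ⟨A₁, π, ‹_›, kernel.lift _ (biprod.lift (-i) (π ≫ y ≫ kernel.ι _)) ?_, ?_⟩
    · rw [hd]
      simp [← reassoc_of% hi]
    · ext
      simp

end ShortExact

/-! ### Splicing short exact sequences into complexes. -/

section Splicing

universe v

/-- Short exact sequences `0 ⟶ Zᵢ ⟶ Xᵢ ⟶ Zᵢ₊₁ ⟶ 0`. -/
structure SplicingData (C : Type u) [Category.{v} C] [Abelian C] (α : Type) [Add α] [One α] where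
  /-- the outer objects -/
  Z : α → C
  /-- the middle objects -/
  X : α → C
  /-- the monomorphisms -/
  f (i : α) : Z i ⟶ X i
  /-- the epimorphisms -/
  g (i : α) : X i ⟶ Z (i + 1)
  zero (i : α) : f i ≫ g i = 0
  shortExact (i : α) : (ShortComplex.mk (f i) (g i) (zero i)).ShortExact

namespace SplicingData

variable {C : Type u} [Category.{v} C] [Abelian C] {α : Type} [AddRightCancelSemigroup α] [One α]
  [DecidableEq α] (S : SplicingData C α)

instance (i : α) : Mono (S.f i) := (S.shortExact i).mono_f

instance (i : α) : Epi (S.g i) := (S.shortExact i).epi_g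

/-- The complex `⋯ ⟶ Xᵢ ⟶ Xᵢ₊₁ ⟶ ⋯` obtained by splicing the short exact sequences. -/
noncomputable abbrev complex : CochainComplex C α :=
  CochainComplex.of S.X (fun i => S.g i ≫ S.f (i + 1)) fun i => by
    rw [Category.assoc, reassoc_of% S.zero (i + 1), zero_comp, comp_zero]

lemma complex_d (i : α) : S.complex.d i (i + 1) = S.g i ≫ S.f (i + 1) :=
  CochainComplex.of_d S.X (fun i => S.g i ≫ S.f (i + 1)) i

lemma comp_complex_d_eq_zero_iff {i : α} {T : C} (x : T ⟶ S.X i) :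
    x ≫ S.complex.d i (i + 1) = 0 ↔ x ≫ S.g i = 0 := by
  rw [complex_d, ← cancel_mono (S.f (i + 1)), zero_comp, Category.assoc]

lemma complex_d_comp_eq_zero_iff {i : α} {T : C} (x : S.X (i + 1) ⟶ T) :
    S.complex.d i (i + 1) ≫ x = 0 ↔ S.f (i + 1) ≫ x = 0 := by
  rw [complex_d, ← cancel_epi (S.g i), comp_zero, Category.assoc]

/-- Morphisms killed by `d` factor through `Zᵢ`. -/
lemma exists_comp_f {i : α} {T : C} (x : T ⟶ S.X i)
    (hx : x ≫ S.complex.d i (i + 1) = 0) : ∃ y : T ⟶ S.Z i, y ≫ S.f i = x :=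
  ⟨(S.shortExact i).exact.lift x ((S.comp_complex_d_eq_zero_iff x).1 hx),
    (S.shortExact i).exact.lift_f _ _⟩

lemma exactAt (i : α) : S.complex.ExactAt (i + 1) := by
  rw [HomologicalComplex.exactAt_iff' _ i (i + 1) (i + 1 + 1) ((ComplexShape.up α).prev_eq' rfl)
    ((ComplexShape.up α).next_eq' rfl), ShortComplex.exact_iff_exact_up_to_refinements]
  intro A x hx
  obtain ⟨y, rfl⟩ := S.exists_comp_f x hx
  obtain ⟨A', π, _, z, hz⟩ := surjective_up_to_refinements_of_epi (S.g i) y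
  refine ⟨A', π, ‹_›, z, ?_⟩
  change _ = z ≫ S.complex.d i (i + 1)
  rw [complex_d, ← reassoc_of% hz]
  rfl

end SplicingData

end Splicing

/-! ### Exactness and cohomology of Hom complexes. -/

section HomComplex

variable {R : Type u} [Ring R] {ι : Type} {c : ComplexShape ι}
  (M : ModuleCat.{u} R) (K : HomologicalComplex (ModuleCat.{u} R) c)

lemma homComplex_exactAt_iff {i j k : ι} (hij : c.Rel i j) (hjk : c.Rel j k) :
    (homComplex M K).ExactAt j ↔
      ∀ x : M ⟶ K.X j, x ≫ K.d j k = 0 → ∃ y : M ⟶ K.X i, y ≫ K.d i j = x := by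
  rw [HomologicalComplex.exactAt_iff' _ i j k (c.prev_eq' hij) (c.next_eq' hjk),
    ShortComplex.ab_exact_iff]
  rfl

lemma subsingleton_homology_homComplex_iff {i j k : ι} (hij : c.Rel i j) (hjk : c.Rel j k) :
    Subsingleton ((homComplex M K).homology j) ↔
      ∀ x : M ⟶ K.X j, x ≫ K.d j k = 0 → ∃ y : M ⟶ K.X i, y ≫ K.d i j = x := by
  rw [← homComplex_exactAt_iff M K hij hjk, HomologicalComplex.exactAt_iff_isZero_homology]
  exact ⟨fun _ => AddCommGrpCat.isZero_of_subsingleton _,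
    fun h => AddCommGrpCat.subsingleton_of_isZero h⟩

lemma SplicingData.homComplex_exactAt {α : Type} [AddRightCancelSemigroup α] [One α]
    [DecidableEq α] (S : SplicingData (ModuleCat.{u} R) α) {i : α}
    (h : ∀ x : M ⟶ S.Z (i + 1), ∃ y : M ⟶ S.X i, y ≫ S.g i = x) :
    (homComplex M S.complex).ExactAt (i + 1) := by
  rw [homComplex_exactAt_iff M S.complex (i := i) (k := i + 1 + 1) rfl rfl]
  intro x hx
  obtain ⟨y, rfl⟩ := S.exists_comp_f x hx
  obtain ⟨z, rfl⟩ := h y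
  exact ⟨z, by rw [S.complex_d, Category.assoc]⟩

end HomComplex

/-! ### Cutting complexes into short exact sequences and gluing them back. -/

section Cosyzygy
universe v
variable {C : Type u} [Category.{v} C] [Abelian C] {α : Type} [AddRightCancelSemigroup α] [One α]

/-- The kernel of `Kⁱ ⟶ Kⁱ⁺¹`. -/
noncomputable abbrev cosyzygy (K : CochainComplex C α) (i : α) : C := kernel (K.d i (i + 1))

variable (K : CochainComplex C α) (i : α)

/-- The morphism from `Kⁱ` to the kernel of `Kⁱ⁺¹ ⟶ Kⁱ⁺²`. -/
noncomputable abbrev toCosyzygy : K.X i ⟶ cosyzygy K (i + 1) :=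
  kernel.lift (K.d (i + 1) (i + 1 + 1)) (K.d i (i + 1)) (by simp)

lemma cosyzygy_zero : kernel.ι (K.d i (i + 1)) ≫ toCosyzygy K i = 0 := by
  ext; simp

variable {K i} in
lemma epi_toCosyzygy (h : K.ExactAt (i + 1)) : Epi (toCosyzygy K i) := by
  rw [HomologicalComplex.exactAt_iff' _ i (i + 1) (i + 1 + 1) ((ComplexShape.up α).prev_eq' rfl)
    ((ComplexShape.up α).next_eq' rfl)] at h
  exact h.epi_kernelLift

variable {K i} in
lemma shortExact_cosyzygy (h : K.ExactAt (i + 1)) :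
    (ShortComplex.mk _ _ (cosyzygy_zero K i)).ShortExact where
  exact := ShortComplex.exact_of_f_is_kernel _ (KernelFork.IsLimit.ofι' _ _ fun {A} k hk => by
    dsimp at k hk
    exact ⟨kernel.lift _ k (by simpa using hk =≫ kernel.ι _), by simp⟩)
  epi_g := epi_toCosyzygy h

end Cosyzygy

section Glue

universe v

variable {C : Type u} [Category.{v} C] [Abelian C]

/-- The cokernel of a morphism whose image is the kernel of an epimorphism `S.g` is `S.X₃`. -/
noncomputable def cokernelIsoOfShortExact {S : ShortComplex C} (hS : S.ShortExact) {A : C}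
    (e : A ⟶ S.X₁) [Epi e] : cokernel (e ≫ S.f) ≅ S.X₃ :=
  cokernelEpiComp e S.f ≪≫ (cokernelIsCokernel S.f).coconePointUniqueUpToIso
    (have := hS.epi_g; hS.gIsCokernel)

/-- Prolong a family of short exact sequences to the left. -/
def SplicingData.extendLeft (S : SplicingData C ℕ) (Z X : ℕ → C) (f : ∀ n, Z n ⟶ X n)
    (g₀ : X 0 ⟶ S.Z 0) (g : ∀ n, X (n + 1) ⟶ Z n) (w₀ : f 0 ≫ g₀ = 0)
    (w : ∀ n, f (n + 1) ≫ g n = 0) (h₀ : (ShortComplex.mk _ _ w₀).ShortExact)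
    (h : ∀ n, (ShortComplex.mk _ _ (w n)).ShortExact) : SplicingData C ℤ where
  Z
    | .ofNat n => S.Z n
    | .negSucc n => Z n
  X
    | .ofNat n => S.X n
    | .negSucc n => X n
  f
    | .ofNat n => S.f n
    | .negSucc n => f n
  g
    | .ofNat n => S.g n
    -- The case split follows the reduction of `i + 1`: `-[0+1] + 1` is `0`, where the two halves
    -- meet, and `-[n+1+1] + 1` is `-[n+1]`.
    | .negSucc 0 => g₀
    | .negSucc (n + 1) => g n
  zero
    | .ofNat n => S.zero n
    | .negSucc 0 => w₀
    | .negSucc (n + 1) => w n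
  shortExact
    | .ofNat n => S.shortExact n
    | .negSucc 0 => h₀
    | .negSucc (n + 1) => h n

/-- Iterated short exact sequences, starting from a rule that embeds the object attached to a state
and produces a next state whose object is the cokernel. -/
def SplicingData.iterate {σ : Type*} (Z X : σ → C) (next : σ → σ) (f : ∀ s, Z s ⟶ X s)
    (g : ∀ s, X s ⟶ Z (next s)) (w : ∀ s, f s ≫ g s = 0)
    (h : ∀ s, (ShortComplex.mk _ _ (w s)).ShortExact) (s : σ) : SplicingData C ℕ :=
  let st : ℕ → σ := fun n => Nat.rec s (fun _ => next) n
  { Z n := Z (st n)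
    X n := X (st n)
    f n := f (st n)
    g n := g (st n)
    zero n := w (st n)
    shortExact n := h (st n) }

variable (C) in
/-- The splicing data of an injective resolution of `M`. -/
noncomputable def SplicingData.injective [EnoughInjectives C] (M : C) : SplicingData C ℕ :=
  .iterate (fun X ↦ X) Injective.under (fun X => cokernel (Injective.ι X)) Injective.ι
    (fun X => cokernel.π (Injective.ι X)) (fun _ => cokernel.condition _)
    (fun X => shortExact_cokernel (Injective.ι X)) M

end Glue

/-! ### Orthogonality to weak injectives and closure properties of Gorenstein weak injectives. -/

variable {R : Type u} [Ring R]

/-- `Extⁱ(W, M) = 0` for all weak injective `W` and all `i > n`. -/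
def ExtVanishesAbove (n : ℕ) (M : ModuleCat.{u} R) : Prop :=
  ∀ W : ModuleCat.{u} R, IsWeakInjective W → ∀ i ≥ n + 1, Subsingleton (Abelian.Ext W M i)

lemma IsWeakInjective.of_injective (I : ModuleCat.{u} R) [Injective I] : IsWeakInjective I :=
  fun N _ => Abelian.Ext.subsingleton_of_injective N I 0

namespace ExtVanishesAbove

lemma of_injective (I : ModuleCat.{u} R) [Injective I] (n : ℕ) : ExtVanishesAbove n I := by
  intro W _ i hi
  obtain ⟨i, rfl⟩ : ∃ j, i = j + 1 := ⟨i - 1, by omega⟩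
  exact Abelian.Ext.subsingleton_of_injective W I i

lemma mono {m n : ℕ} (h : m ≤ n) {M : ModuleCat.{u} R} (hM : ExtVanishesAbove m M) :
    ExtVanishesAbove n M := fun W hW i hi => hM W hW i (by omega)

lemma of_retract {n : ℕ} {M N : ModuleCat.{u} R} (hN : ExtVanishesAbove n N) (i : M ⟶ N)
    (r : N ⟶ M) (h : i ≫ r = 𝟙 M) : ExtVanishesAbove n M := fun W hW k hk =>
  have := hN W hW k hk
  subsingleton_ext_of_retract i r h k

lemma of_iso {n : ℕ} {M N : ModuleCat.{u} R} (hN : ExtVanishesAbove n N) (e : M ≅ N) :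
    ExtVanishesAbove n M :=
  hN.of_retract e.hom e.inv e.hom_inv_id

variable {S : ShortComplex (ModuleCat.{u} R)} (hS : S.ShortExact) {n : ℕ}
include hS

lemma X₁ (h₂ : ExtVanishesAbove (n + 1) S.X₂) (h₃ : ExtVanishesAbove n S.X₃) :
    ExtVanishesAbove (n + 1) S.X₁ := by
  intro W hW i hi
  obtain ⟨i, rfl⟩ : ∃ j, i = j + 1 := ⟨i - 1, by omega⟩
  exact subsingleton_ext_X₁ hS W i (h₂ W hW _ hi) (h₃ W hW _ (by omega))

lemma X₂ (h₁ : ExtVanishesAbove n S.X₁) (h₃ : ExtVanishesAbove n S.X₃) :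
    ExtVanishesAbove n S.X₂ :=
  fun W hW i hi => subsingleton_ext_X₂ hS W i (h₁ W hW _ hi) (h₃ W hW _ hi)

lemma X₃ (h₁ : ExtVanishesAbove (n + 1) S.X₁) (h₂ : ExtVanishesAbove n S.X₂) :
    ExtVanishesAbove n S.X₃ :=
  fun W hW i hi => subsingleton_ext_X₃ hS W i (h₁ W hW _ (by omega)) (h₂ W hW _ hi)

lemma X₁_of_exists_lift (h₂ : ExtVanishesAbove 0 S.X₂) (h₃ : ExtVanishesAbove 0 S.X₃)
    (h : ∀ W : ModuleCat.{u} R, IsWeakInjective W → ∀ f : W ⟶ S.X₃, ∃ f' : W ⟶ S.X₂, f' ≫ S.g = f) :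
    ExtVanishesAbove 0 S.X₁ := by
  intro W hW i hi
  obtain rfl | hi' : i = 1 ∨ 1 + 1 ≤ i := by omega
  · exact subsingleton_ext_one_of_exists_lift hS (h₂ W hW 1 le_rfl) (h W hW)
  · exact X₁ hS (h₂.mono zero_le_one) h₃ W hW i hi'

lemma exists_lift (h₁ : ExtVanishesAbove 0 S.X₁) {W : ModuleCat.{u} R} (hW : IsWeakInjective W)
    (f : W ⟶ S.X₃) : ∃ f' : W ⟶ S.X₂, f' ≫ S.g = f :=
  exists_lift_of_subsingleton_ext hS (h₁ W hW 1 le_rfl) f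

end ExtVanishesAbove

lemma IsGorensteinWeakInjective.of_iso {M N : ModuleCat.{u} R} (hN : IsGorensteinWeakInjective N)
    (e : M ≅ N) : IsGorensteinWeakInjective M := by
  obtain ⟨I, h₁, h₂, h₃, ⟨e'⟩⟩ := hN
  exact ⟨I, h₁, h₂, h₃, ⟨e ≪≫ e'⟩⟩

lemma SplicingData.isGorensteinWeakInjective (S : SplicingData (ModuleCat.{u} R) ℤ)
    (hX : ∀ i, Injective (S.X i)) (hZ : ∀ i, ExtVanishesAbove 0 (S.Z i)) :
    IsGorensteinWeakInjective (S.Z 0) := by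
  refine ⟨S.complex, hX, fun i => ?_, fun W hW i => ?_, ⟨Iso.symm ?_⟩⟩
  · obtain ⟨i, rfl⟩ : ∃ j, i = j + 1 := ⟨i - 1, by omega⟩
    exact S.exactAt i
  · obtain ⟨i, rfl⟩ : ∃ j, i = j + 1 := ⟨i - 1, by omega⟩
    exact S.homComplex_exactAt W fun x => (hZ i).exists_lift (S.shortExact i) hW x
  -- The differential out of degree -2 is an epimorphism onto `S.Z (-1)` followed by `S.f (-1)`,
  -- whose cokernel is `S.Z 0`.
  · exact cokernelIsoOfEq (S.complex_d (-2)) ≪≫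
      cokernelIsoOfShortExact (S.shortExact (-1)) (S.g (-2))

/-- A class of modules consists of Gorenstein weak injective modules if its members are right
orthogonal to the weak injective modules and admit epimorphisms from injective modules whose
kernels are again in the class. -/
theorem isGorensteinWeakInjective_of_coinduction (P : ModuleCat.{u} R → Prop)
    (hP₁ : ∀ X, P X → ExtVanishesAbove 0 X)
    (hP₂ : ∀ X, P X → ∃ (I : ModuleCat.{u} R) (p : I ⟶ X), Injective I ∧ Epi p ∧ P (kernel p))
    {M : ModuleCat.{u} R} (hM : P M) : IsGorensteinWeakInjective M := by
  choose I p hI hp hk using fun X : {X // P X} => hP₂ X.1 X.2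
  let L : ℕ → {X // P X} := fun n => Nat.rec ⟨M, hM⟩ (fun _ X => ⟨kernel (p X), hk X⟩) n
  let S : SplicingData (ModuleCat.{u} R) ℤ := (SplicingData.injective _ M).extendLeft
    (fun n => (L (n + 1)).1) (fun n => I (L n)) (fun n => kernel.ι (p (L n))) (p (L 0))
    (fun n => p (L (n + 1))) (kernel.condition _) (fun n => kernel.condition _)
    (have := hp (L 0); shortExact_kernel (p (L 0)))
    (fun n => have := hp (L (n + 1)); shortExact_kernel (p (L (n + 1))))
  have hX : ∀ i, Injective (S.X i)
    | .ofNat n => inferInstanceAs (Injective (Injective.under _))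
    | .negSucc n => hI _
  -- On the right half no choice matters: cosyzygies of an orthogonal module in any injective
  -- resolution stay orthogonal.
  have hZ : ∀ n : ℕ, ExtVanishesAbove 0 (S.Z n) := fun n => by
    induction n with
    | zero => exact hP₁ M hM
    | succ n ih =>
      have := hX n
      exact ExtVanishesAbove.X₃ (S.shortExact n) (ih.mono zero_le_one)
        (ExtVanishesAbove.of_injective (S.X n) 0)
  exact S.isGorensteinWeakInjective hX fun
    | .ofNat n => hZ n
    | .negSucc n => hP₁ _ (L (n + 1)).2

/-- Exactness of Hom(W, I) gives Ext¹; injectivity of the terms then moves Extᵏ⁺² at index i to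
Extᵏ⁺¹ at index i + 1, so the induction must treat all i at once. -/
lemma extVanishesAbove_cosyzygy {I : CochainComplex (ModuleCat.{u} R) ℤ}
    (h₁ : ∀ i, Injective (I.X i)) (h₂ : I.Acyclic)
    (h₃ : ∀ W : ModuleCat.{u} R, IsWeakInjective W → (homComplex W I).Acyclic) (i : ℤ) :
    ExtVanishesAbove 0 (cosyzygy I i) := by
  suffices H : ∀ (k : ℕ) (i : ℤ) (W : ModuleCat.{u} R), IsWeakInjective W →
      Subsingleton (Abelian.Ext W (cosyzygy I i) (k + 1)) by
    intro W hW k hk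
    obtain ⟨k, rfl⟩ : ∃ j, k = j + 1 := ⟨k - 1, by omega⟩
    exact H k i W hW
  intro k
  induction k with
  | zero =>
    intro i W hW
    have := h₁ i
    refine subsingleton_ext_one_of_exists_lift (shortExact_cosyzygy (h₂ (i + 1)))
      (Abelian.Ext.subsingleton_of_injective W (I.X i) 0) fun f => ?_
    obtain ⟨y, hy⟩ := (homComplex_exactAt_iff W I (i := i) (k := i + 1 + 1) rfl rfl).1
      (h₃ W hW (i + 1)) (f ≫ kernel.ι _) (by simp)
    exact ⟨y, by rw [← cancel_mono (kernel.ι _)]; simpa using hy⟩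
  | succ k ih =>
    intro i W hW
    have := h₁ i
    exact subsingleton_ext_X₁ (shortExact_cosyzygy (h₂ (i + 1))) W (k + 1)
      (Abelian.Ext.subsingleton_of_injective W (I.X i) _) (ih (i + 1) W hW)

/-- Coinduction on the class of all cosyzygies up to isomorphism replaces a reindexing of the
complex. -/
lemma isGorensteinWeakInjective_cosyzygy {I : CochainComplex (ModuleCat.{u} R) ℤ}
    (h₁ : ∀ i, Injective (I.X i)) (h₂ : I.Acyclic)
    (h₃ : ∀ W : ModuleCat.{u} R, IsWeakInjective W → (homComplex W I).Acyclic) (i : ℤ) :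
    IsGorensteinWeakInjective (cosyzygy I i) := by
  refine isGorensteinWeakInjective_of_coinduction (fun X => ∃ i, Nonempty (X ≅ cosyzygy I i))
    ?_ ?_ ⟨i, ⟨Iso.refl _⟩⟩
  · rintro X ⟨i, ⟨e⟩⟩
    exact (extVanishesAbove_cosyzygy h₁ h₂ h₃ i).of_iso e
  · rintro X ⟨i, ⟨e⟩⟩
    obtain ⟨i, rfl⟩ : ∃ j, i = j + 1 := ⟨i - 1, by omega⟩
    have hS := shortExact_cosyzygy (h₂ (i + 1))
    have := hS.epi_g
    have := hS.mono_f
    refine ⟨I.X i, toCosyzygy I i ≫ e.inv, h₁ i, epi_comp _ _, i, ⟨?_⟩⟩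
    exact kernelCompMono _ _ ≪≫
      (kernelIsKernel _).conePointUniqueUpToIso hS.fIsKernel

namespace IsGorensteinWeakInjective

lemma exists_iso_cosyzygy {M : ModuleCat.{u} R} (hM : IsGorensteinWeakInjective M) :
    ∃ I : CochainComplex (ModuleCat.{u} R) ℤ, (∀ i, Injective (I.X i)) ∧ I.Acyclic ∧
      (∀ W : ModuleCat.{u} R, IsWeakInjective W → (homComplex W I).Acyclic) ∧
      Nonempty (M ≅ cosyzygy I 0) := by
  obtain ⟨I, h₁, h₂, h₃, ⟨e⟩⟩ := hM
  have := epi_toCosyzygy (h₂ (-2 + 1))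
  refine ⟨I, h₁, h₂, h₃, ⟨e ≪≫ cokernelIsoOfEq ?_ ≪≫
    cokernelIsoOfShortExact (shortExact_cosyzygy (h₂ (-1 + 1))) (toCosyzygy I (-2))⟩⟩
  exact (kernel.lift_ι _ _ _).symm

lemma extVanishesAbove {M : ModuleCat.{u} R} (hM : IsGorensteinWeakInjective M) (n : ℕ) :
    ExtVanishesAbove n M := by
  obtain ⟨I, h₁, h₂, h₃, ⟨e⟩⟩ := hM.exists_iso_cosyzygy
  exact ((extVanishesAbove_cosyzygy h₁ h₂ h₃ 0).of_iso e).mono (Nat.zero_le n)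

/-- A Gorenstein weak injective module is a quotient of an injective module by a Gorenstein weak
injective submodule. -/
lemma exists_epi {M : ModuleCat.{u} R} (hM : IsGorensteinWeakInjective M) :
    ∃ (I : ModuleCat.{u} R) (p : I ⟶ M), Injective I ∧ Epi p ∧
      IsGorensteinWeakInjective (kernel p) := by
  obtain ⟨I, h₁, h₂, h₃, ⟨e⟩⟩ := hM.exists_iso_cosyzygy
  have hS := shortExact_cosyzygy (h₂ (-1 + 1))
  have := hS.epi_g
  have := hS.mono_f
  have he : Epi (toCosyzygy I (-1) ≫ e.inv) := epi_comp _ _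
  exact ⟨I.X (-1), toCosyzygy I (-1) ≫ e.inv, h₁ _, he,
    (isGorensteinWeakInjective_cosyzygy h₁ h₂ h₃ (-1)).of_iso
    (kernelCompMono _ _ ≪≫ (kernelIsKernel _).conePointUniqueUpToIso hS.fIsKernel)⟩

lemma of_injective (I : ModuleCat.{u} R) [Injective I] : IsGorensteinWeakInjective I := by
  refine isGorensteinWeakInjective_of_coinduction (fun X => Injective X)
    (fun X _ => ExtVanishesAbove.of_injective X 0)
    (fun X _ => ⟨X, 𝟙 X, ‹_›, inferInstance, ?_⟩) ‹Injective I›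
  exact (isZero_kernel_of_mono (𝟙 X)).injective

/-- Horseshoe argument: J ⟶ X₃ lifts to X₂ because J is weak injective and X₁ is orthogonal, and the
kernels again form an extension of the same kind. -/
lemma of_shortExact {S : ShortComplex (ModuleCat.{u} R)} (hS : S.ShortExact)
    (h₁ : IsGorensteinWeakInjective S.X₁) (h₃ : IsGorensteinWeakInjective S.X₃) :
    IsGorensteinWeakInjective S.X₂ := by
  refine isGorensteinWeakInjective_of_coinduction
    (fun X => ∃ S : ShortComplex (ModuleCat.{u} R), S.ShortExact ∧ IsGorensteinWeakInjective S.X₁ ∧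
      IsGorensteinWeakInjective S.X₃ ∧ S.X₂ = X) ?_ ?_ ⟨S, hS, h₁, h₃, rfl⟩
  · rintro _ ⟨S, hS, h₁, h₃, rfl⟩
    exact ExtVanishesAbove.X₂ hS (h₁.extVanishesAbove 0) (h₃.extVanishesAbove 0)
  · rintro _ ⟨S, hS, h₁, h₃, rfl⟩
    obtain ⟨I, p, _, _, hp⟩ := h₁.exists_epi
    obtain ⟨J, q, _, hq, hq'⟩ := h₃.exists_epi
    obtain ⟨q, rfl⟩ := (h₁.extVanishesAbove 0).exists_lift hS (.of_injective J) q
    exact ⟨I ⊞ J, biprod.desc (p ≫ S.f) q, inferInstance, epi_biprod_desc hS p q, _,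
      shortExact_kernel_biprod_desc hS p q, hp, hq', rfl⟩

end IsGorensteinWeakInjective

/-! ### Gorenstein weak injective approximations. -/

variable {R : Type u} [Ring R]

/-- `M` has a finite coresolution by weak injective modules. -/
inductive HasFiniteWeakInjectiveCoresolution : ModuleCat.{u} R → Prop
  | of_isWeakInjective {M : ModuleCat.{u} R} (hM : IsWeakInjective M) :
      HasFiniteWeakInjectiveCoresolution M
  | of_shortExact {S : ShortComplex (ModuleCat.{u} R)} (hS : S.ShortExact)
      (h₂ : IsWeakInjective S.X₂) (h₃ : HasFiniteWeakInjectiveCoresolution S.X₃) :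
      HasFiniteWeakInjectiveCoresolution S.X₁

namespace HasFiniteWeakInjectiveCoresolution

lemma subsingleton_ext {A : ModuleCat.{u} R} (hA : HasFiniteWeakInjectiveCoresolution A) {n : ℕ}
    {M : ModuleCat.{u} R} (hM : ExtVanishesAbove n M) (i : ℕ) (hi : i ≥ n + 1) :
    Subsingleton (Abelian.Ext A M i) := by
  induction hA generalizing i with
  | of_isWeakInjective h => exact hM _ h i hi
  | of_shortExact hS h₂ _ ih =>
    exact subsingleton_ext_X₁_left hS M i (hM _ h₂ i hi) (ih (i + 1) (by omega))

/-- Passing to the cokernel of an embedding into an injective lowers the vanishing degree by one. -/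
lemma of_wid_lt_top {W : ModuleCat.{u} R} (hW : wid W < ⊤) :
    HasFiniteWeakInjectiveCoresolution W := by
  obtain ⟨_, ⟨n, -, h⟩, -⟩ := sInf_lt_iff.1 hW
  clear hW
  induction n generalizing W with
  | zero => exact .of_isWeakInjective h
  | succ n ih =>
    have hS := shortExact_cokernel (Injective.ι W)
    refine .of_shortExact hS (.of_injective _) (ih fun N hN => ?_)
    exact subsingleton_ext_X₃ hS N (n + 1) (h N hN)
      (Abelian.Ext.subsingleton_of_injective N (Injective.under W) n)

end HasFiniteWeakInjectiveCoresolution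

lemma IsWeakInjective.wid_lt_top {W : ModuleCat.{u} R} (hW : IsWeakInjective W) : wid W < ⊤ :=
  sInf_lt_iff.2 ⟨0, ⟨0, rfl, hW⟩, ENat.natCast_lt_top 0⟩

/-- There is a short exact sequence `0 ⟶ M ⟶ G ⟶ A ⟶ 0` with `G` Gorenstein weak injective such that
`A` has a finite coresolution by weak injective modules. -/
def HasGWIApproximation (M : ModuleCat.{u} R) : Prop :=
  ∃ (G A : ModuleCat.{u} R) (i : M ⟶ G) (p : G ⟶ A) (w : i ≫ p = 0),
    (ShortComplex.mk i p w).ShortExact ∧ IsGorensteinWeakInjective G ∧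
      HasFiniteWeakInjectiveCoresolution A

namespace HasGWIApproximation

lemma of_iso {M N : ModuleCat.{u} R} (hN : HasGWIApproximation N) (e : M ≅ N) :
    HasGWIApproximation M := by
  obtain ⟨G, A, i, p, w, hS, hG, hA⟩ := hN
  exact ⟨G, A, e.hom ≫ i, p, _, shortExact_comp_iso_left hS e, hG, hA⟩

lemma of_isGorensteinWeakInjective {M : ModuleCat.{u} R} (hM : IsGorensteinWeakInjective M) :
    HasGWIApproximation M :=
  ⟨M, _, 𝟙 M, _, _, shortExact_cokernel (𝟙 M), hM, .of_isWeakInjective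
    (have := (isZero_cokernel_of_epi (𝟙 M)).injective; .of_injective _)⟩

/-- Given 0 → T₃ → G → A → 0, take I ⟶ G epi with I injective and Gorenstein weak injective kernel
K, and let L = T₃ ×_G I. Then L embeds in I with cokernel A, so it is finitely coresolved. The
pullback Y = T₂ ×_{T₃} L is an extension of L by T₁, and also of T₂ by K, hence Gorenstein weak
injective. -/
lemma X₁ {T : ShortComplex (ModuleCat.{u} R)} (hT : T.ShortExact)
    (h₂ : IsGorensteinWeakInjective T.X₂) (h₃ : HasGWIApproximation T.X₃) :
    HasGWIApproximation T.X₁ := by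
  obtain ⟨G, A, i, q, w, hS, hG, hA⟩ := h₃
  obtain ⟨I, p, _, _, hp⟩ := hG.exists_epi
  have hL : HasFiniteWeakInjectiveCoresolution (pullback i p) :=
    .of_shortExact (shortExact_pullback_of_epi hS p) (.of_injective I) hA
  have hK := shortExact_pullback_fst (shortExact_kernel p) i
  exact ⟨_, _, _, _, _, shortExact_pullback_snd hT (pullback.fst i p),
    .of_shortExact (shortExact_pullback_fst hK T.g) hp h₂, hL⟩

end HasGWIApproximation

/-- If every module has an approximation by a Gorenstein weak injective module, then the Gorenstein
weak injective modules are the right orthogonal of the weak injective modules. -/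
theorem ExtVanishesAbove.isGorensteinWeakInjective
    (hR : ∀ M : ModuleCat.{u} R, HasGWIApproximation M) {M : ModuleCat.{u} R}
    (hM : ExtVanishesAbove 0 M) : IsGorensteinWeakInjective M := by
  refine isGorensteinWeakInjective_of_coinduction (ExtVanishesAbove 0) (fun _ h => h)
    (fun X hX => ?_) hM
  obtain ⟨G, A, i, q, w, hS, hG, hA⟩ := hR X
  -- The approximation of `X` splits, so `X` is a retract of `G`.
  obtain ⟨r, hr⟩ := exists_extension_of_subsingleton_ext hS (hA.subsingleton_ext hX 1 le_rfl) (𝟙 X)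
  obtain ⟨I, p, _, _, hp⟩ := hG.exists_epi
  have : Epi r := epi_of_epi_fac hr
  refine ⟨I, p ≫ r, ‹_›, epi_comp _ _, ?_⟩
  refine ExtVanishesAbove.X₁_of_exists_lift (shortExact_kernel (p ≫ r)) (.of_injective I 0) hX
    fun W hW f => ?_
  -- To lift `f` along `p ≫ r`, lift `f ≫ i` along `p`; composing with `r` recovers `f`.
  obtain ⟨f', hf'⟩ := (hp.extVanishesAbove 0).exists_lift (shortExact_kernel p) hW (f ≫ i)
  dsimp at hf' hr ⊢
  exact ⟨f', by rw [reassoc_of% hf', hr, Category.comp_id]⟩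

/-! ### Dimension shifting along coresolutions. -/

namespace CoaugmentedComplex

variable {M : ModuleCat.{u} R} {C : CoaugmentedComplex M}

/-- The morphism from `M` to the kernel of `X⁰ ⟶ X¹`. -/
noncomputable abbrev toCosyzygyZero (C : CoaugmentedComplex M) : M ⟶ cosyzygy C.cocomplex 0 :=
  kernel.lift _ C.ι C.ι_comp_d

lemma IsExact.isIso_toCosyzygyZero (hC : C.IsExact) : IsIso C.toCosyzygyZero := by
  have := hC.1
  have : Epi C.toCosyzygyZero := hC.2.1.epi_kernelLift
  have : Mono C.toCosyzygyZero := mono_of_mono_fac (kernel.lift_ι _ _ _)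
  exact isIso_of_mono_of_epi _

/-- Dimension shifting along an exact sequence `0 ⟶ M ⟶ G⁰ ⟶ ⋯ ⟶ Gⁿ⁻¹ ⟶ Zⁿ ⟶ 0`. -/
lemma IsExact.extVanishesAbove_iff (hC : C.IsExact) {n : ℕ}
    (h : ∀ i < n, IsGorensteinWeakInjective (C.cocomplex.X i)) :
    ExtVanishesAbove n M ↔ ExtVanishesAbove 0 (cosyzygy C.cocomplex n) := by
  have := hC.isIso_toCosyzygyZero
  have H : ∀ k i, i + k = n → (ExtVanishesAbove k (cosyzygy C.cocomplex i) ↔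
      ExtVanishesAbove 0 (cosyzygy C.cocomplex n)) := by
    intro k
    induction k with
    | zero => rintro i rfl; rfl
    | succ k ih =>
      intro i hi
      rw [← ih (i + 1) (by omega)]
      have hS := shortExact_cosyzygy (hC.2.2 i)
      have hX := h i (by omega)
      exact ⟨fun h => ExtVanishesAbove.X₃ hS h (hX.extVanishesAbove k),
        fun h => ExtVanishesAbove.X₁ hS (hX.extVanishesAbove (k + 1)) h⟩
  rw [← H n 0 (zero_add n)]
  exact ⟨fun h => h.of_iso (asIso C.toCosyzygyZero).symm,
    fun h => h.of_iso (asIso C.toCosyzygyZero)⟩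

/-- Identifies the last cosyzygy with the last term: the differential leaving it has zero target. -/
lemma IsExactOfLength.isIso_kernelι {n : ℕ} (hC : C.IsExactOfLength n) :
    IsIso (kernel.ι (C.cocomplex.d n (n + 1))) := by
  have h := (hC.2 (n + 1) (by omega)).eq_of_tgt (C.cocomplex.d n (n + 1)) 0
  rw [h]
  infer_instance

lemma IsExactOfLength.hasGWIApproximation {n : ℕ} (hC : C.IsExactOfLength n)
    (h : ∀ i ≤ n, IsGorensteinWeakInjective (C.cocomplex.X i)) : HasGWIApproximation M := by
  have := hC.isIso_kernelι
  have := hC.1.isIso_toCosyzygyZero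
  have H : ∀ k i, i + k = n → HasGWIApproximation (cosyzygy C.cocomplex i) := by
    intro k
    induction k with
    | zero =>
      rintro i rfl
      exact .of_isGorensteinWeakInjective ((h i le_rfl).of_iso (asIso (kernel.ι _)))
    | succ k ih =>
      intro i hi
      exact .X₁ (shortExact_cosyzygy (hC.1.2.2 i)) (h i (by omega)) (ih (i + 1) (by omega))
  exact (H n 0 (zero_add n)).of_iso (asIso C.toCosyzygyZero)

end CoaugmentedComplex

lemma exists_of_Gwid_le {M : ModuleCat.{u} R} {n : ℕ} (h : Gwid M ≤ n) :
    ∃ m ≤ n, ∃ C : CoaugmentedComplex M, C.IsExactOfLength m ∧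
      ∀ i ≤ m, IsGorensteinWeakInjective (C.cocomplex.X i) := by
  -- Bounding by n + 1 makes the inequality strict, so an actual coresolution can be extracted from
  -- the infimum.
  obtain ⟨_, ⟨m, rfl, hC⟩, hm⟩ := sInf_lt_iff.1 (h.trans_lt (ENat.natCast_lt_natCast.2 n.lt_succ_self))
  exact ⟨m, Nat.lt_succ_iff.1 (ENat.natCast_lt_natCast.1 hm), hC⟩

lemma hasGWIApproximation_of_leftGwiD_lt_top (hR : leftGwiD R < ⊤) (M : ModuleCat.{u} R) :
    HasGWIApproximation M := by
  obtain ⟨n, hn⟩ := ENat.ne_top_iff_exists.1 ((le_iSup Gwid M).trans_lt hR).ne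
  obtain ⟨m, -, C, hC, h⟩ := exists_of_Gwid_le hn.ge
  exact hC.hasGWIApproximation h

/-! ### Coaugmented complexes from splicing, and truncated injective resolutions. -/

section Coaugmented

variable (S : SplicingData (ModuleCat.{u} R) ℕ)

/-- The complex `0 ⟶ Z⁰ ⟶ X⁰ ⟶ X¹ ⟶ ⋯`. -/
noncomputable def SplicingData.coaugmentedComplex : CoaugmentedComplex (S.Z 0) where
  cocomplex := S.complex
  ι := S.f 0
  ι_comp_d := (S.comp_complex_d_eq_zero_iff _).2 (S.zero 0)

lemma SplicingData.isExact_coaugmentedComplex : S.coaugmentedComplex.IsExact := by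
  refine ⟨inferInstanceAs (Mono (S.f 0)), ?_, S.exactAt⟩
  have : Mono (ShortComplex.mk _ _ S.coaugmentedComplex.ι_comp_d).f := inferInstanceAs (Mono (S.f 0))
  exact ShortComplex.exact_of_f_is_kernel _ (KernelFork.IsLimit.ofι' _ _ fun {A} k hk =>
    ⟨_, (S.exists_comp_f k hk).choose_spec⟩)

/-- A map on Xⁱ killed by Zⁱ descends to Zⁱ⁺¹, and then extends to Xⁱ⁺¹. -/
lemma SplicingData.isHomExact_coaugmentedComplex (G : ModuleCat.{u} R)
    (h : ∀ (i : ℕ) (x : S.Z i ⟶ G), ∃ y, S.f i ≫ y = x) : S.coaugmentedComplex.IsHomExact G := by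
  have key : ∀ (i : ℕ) (x : S.X i ⟶ G), S.f i ≫ x = 0 →
      ∃ y : S.X (i + 1) ⟶ G, S.complex.d i (i + 1) ≫ y = x := fun i x hx => by
    obtain ⟨y, hy⟩ := h (i + 1) ((S.shortExact i).exact.desc x hx)
    exact ⟨y, by rw [S.complex_d, Category.assoc, hy]; exact (S.shortExact i).exact.g_desc x hx⟩
  exact ⟨h 0, key 0, fun i x hx => key (i + 1) x ((S.complex_d_comp_eq_zero_iff x).1 hx)⟩

/-- An injective module containing `s.2` if `s.1 ≠ 0`, and `s.2` otherwise. -/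
noncomputable def truncatedInjectiveX : ℕ × ModuleCat.{u} R → ModuleCat.{u} R
  | (0, M) => M
  | (_ + 1, M) => Injective.under M

/-- The embedding of the module `s.2` into an injective module if `s.1 ≠ 0`, and its identity
otherwise. -/
noncomputable def truncatedInjectiveι : ∀ s : ℕ × ModuleCat.{u} R, s.2 ⟶ truncatedInjectiveX s
  | (0, M) => 𝟙 M
  | (_ + 1, M) => Injective.ι M

instance : ∀ s : ℕ × ModuleCat.{u} R, Mono (truncatedInjectiveι s)
  | (0, M) => inferInstanceAs (Mono (𝟙 M))
  | (_ + 1, M) => inferInstanceAs (Mono (Injective.ι M))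

/-- The splicing data of the exact sequence `0 ⟶ M ⟶ I⁰ ⟶ ⋯ ⟶ Iⁿ⁻¹ ⟶ C ⟶ 0` obtained by truncating an
injective resolution of `M`. -/
noncomputable def truncatedInjective (n : ℕ) (M : ModuleCat.{u} R) :
    SplicingData (ModuleCat.{u} R) ℕ :=
  .iterate (σ := ℕ × ModuleCat.{u} R) Prod.snd truncatedInjectiveX
    (fun s => (s.1 - 1, cokernel (truncatedInjectiveι s))) truncatedInjectiveι
    (fun s => cokernel.π (truncatedInjectiveι s)) (fun _ => cokernel.condition _)
    (fun s => shortExact_cokernel (truncatedInjectiveι s)) (n, M)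

lemma exists_isExactOfLength_injective (M : ModuleCat.{u} R) (n : ℕ) :
    ∃ C : CoaugmentedComplex M, C.IsExactOfLength n ∧ ∀ i < n, Injective (C.cocomplex.X i) := by
  -- The first component counts the injective terms still to come; at `0` the identity is used and
  -- all later terms vanish.
  let st : ℕ → ℕ × ModuleCat.{u} R := fun i =>
    Nat.rec (n, M) (fun _ s => (s.1 - 1, cokernel (truncatedInjectiveι s))) i
  have hst : ∀ i, (st i).1 = n - i := fun i => by
    induction i with
    | zero => rfl
    | succ i ih => exact (congrArg (· - 1) ih).trans (Nat.sub_sub n i 1)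
  have hz : ∀ s : ℕ × ModuleCat.{u} R, s.1 = 0 → IsZero (cokernel (truncatedInjectiveι s)) := by
    rintro ⟨_, M⟩ rfl
    exact isZero_cokernel_of_epi (𝟙 M)
  have hX : ∀ s : ℕ × ModuleCat.{u} R, s.1 ≠ 0 →
      Injective (truncatedInjectiveX s) := by
    rintro ⟨_ | k, M⟩ h
    · exact absurd rfl h
    · exact inferInstanceAs (Injective (Injective.under M))
  have hX' : ∀ s : ℕ × ModuleCat.{u} R, s.1 = 0 → IsZero s.2 →
      IsZero (truncatedInjectiveX s) := by
    rintro ⟨_, M⟩ rfl h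
    exact h
  refine ⟨(truncatedInjective n M).coaugmentedComplex,
    ⟨SplicingData.isExact_coaugmentedComplex _, fun i hi => ?_⟩, fun i hi => ?_⟩
  · obtain ⟨i, rfl⟩ : ∃ j, i = j + 1 := ⟨i - 1, by omega⟩
    -- Here n ≤ i, so the counter is already `0` at stage i and the next object is the cokernel of
    -- an identity.
    exact hX' (st (i + 1)) ((hst (i + 1)).trans (by omega)) (hz (st i) (by have := hst i; omega))
  · exact hX (st i) (by have := hst i; omega)

end Coaugmented

/-! ### Proper resolutions and relative Ext. -/

variable {R : Type u} [Ring R]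

/-- Iterating approximations yields a proper right resolution. -/
theorem nonempty_properRightGWIResolution (hR : ∀ M : ModuleCat.{u} R, HasGWIApproximation M)
    (N : ModuleCat.{u} R) : Nonempty (ProperRightGWIResolution N) := by
  choose X next f g w hS hX hA using hR
  let S := SplicingData.iterate (fun M => M) X next f g w hS N
  exact ⟨{
    toCoaugmentedComplex := S.coaugmentedComplex
    gorensteinWeakInjective := fun i => hX _
    isHomExact := fun G hG => S.isHomExact_coaugmentedComplex G fun i x =>
      exists_extension_of_subsingleton_ext (S.shortExact i)
        ((hA _).subsingleton_ext (hG.extVanishesAbove 0) 1 le_rfl) x }⟩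

/-- Injectives detect exactness: embed Coker f in an injective and extend that embedding along g,
which forces Coker f ⟶ B to be mono. -/
lemma CoaugmentedComplex.isExact_of_isHomExact {M : ModuleCat.{u} R} {C : CoaugmentedComplex M}
    (hC : ∀ I : ModuleCat.{u} R, Injective I → C.IsHomExact I) : C.IsExact := by
  have key : ∀ {A X B : ModuleCat.{u} R} (f : A ⟶ X) (g : X ⟶ B) (w : f ≫ g = 0),
      (∀ I : ModuleCat.{u} R, Injective I → ∀ x : X ⟶ I, f ≫ x = 0 → ∃ y : B ⟶ I, g ≫ y = x) →
      (ShortComplex.mk f g w).Exact := by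
    intro A X B f g w h
    rw [ShortComplex.exact_iff_mono_cokernel_desc]
    obtain ⟨y, hy⟩ := h (Injective.under (cokernel f)) inferInstance
      (cokernel.π f ≫ Injective.ι (cokernel f)) (by simp)
    have hy' : cokernel.desc f g w ≫ y = Injective.ι (cokernel f) := by
      rw [← cancel_epi (cokernel.π f), cokernel.π_desc_assoc, hy]
    exact mono_of_mono_fac hy'
  refine ⟨?_, key _ _ _ fun I hI => (hC I hI).2.1, fun i => ?_⟩
  · obtain ⟨y, hy⟩ := (hC (Injective.under M) inferInstance).1 (Injective.ι M)
    exact mono_of_mono_fac hy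
  · rw [HomologicalComplex.exactAt_iff' _ i (i + 1) (i + 1 + 1) ((ComplexShape.up ℕ).prev_eq' rfl)
      ((ComplexShape.up ℕ).next_eq' rfl)]
    exact key _ _ _ fun I hI => (hC I hI).2.2 i

namespace ProperRightGWIResolution

variable {N : ModuleCat.{u} R} (G : ProperRightGWIResolution N)

lemma isExact : G.IsExact :=
  CoaugmentedComplex.isExact_of_isHomExact fun I _ => G.isHomExact I (.of_injective I)

lemma subsingleton_extGWI_iff (M : ModuleCat.{u} R) (i : ℕ) :
    Subsingleton (ExtGWI M G (i + 1)) ↔ ∀ x : M ⟶ G.cocomplex.X (i + 1),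
      x ≫ G.cocomplex.d (i + 1) (i + 1 + 1) = 0 →
        ∃ y : M ⟶ G.cocomplex.X i, y ≫ G.cocomplex.d i (i + 1) = x :=
  subsingleton_homology_homComplex_iff M G.cocomplex rfl rfl

/-- If `Ext^{n+1}_GWI(-, N) = 0`, then the `n`-th cosyzygy is a direct summand of `Gⁿ`. -/
lemma extVanishesAbove_cosyzygy {n : ℕ}
    (h : ∀ M : ModuleCat.{u} R, Subsingleton (ExtGWI M G (n + 1))) :
    ExtVanishesAbove 0 (cosyzygy G.cocomplex n) := by
  -- Test on M the (n+1)-st cosyzygy: its inclusion is a cocycle, and being a coboundary means that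
  -- Gⁿ ⟶ M has a section.
  obtain ⟨s, hs⟩ := (G.subsingleton_extGWI_iff _ n).1 (h (cosyzygy G.cocomplex (n + 1)))
    (kernel.ι _) (kernel.condition _)
  have hS := shortExact_cosyzygy (G.isExact.2.2 n)
  have hs' : s ≫ toCosyzygy G.cocomplex n = 𝟙 _ := by
    rw [← cancel_mono (kernel.ι _)]
    simpa using hs
  let σ := ShortComplex.Splitting.ofExactOfSection _ hS.exact s hs' hS.mono_f
  exact ((G.gorensteinWeakInjective n).extVanishesAbove 0).of_retract _ σ.r σ.f_r

/-- Properness is applied with the cosyzygy Zⁿ itself as target: the surjection onto Zⁿ from the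
preceding term factors through Gⁿ. The cases n = 0, n = 1 and n ≥ 2 match the three clauses of
`IsHomExact`. -/
lemma exists_retraction {n : ℕ} (h : IsGorensteinWeakInjective (cosyzygy G.cocomplex n)) :
    ∃ r : G.cocomplex.X n ⟶ cosyzygy G.cocomplex n, kernel.ι _ ≫ r = 𝟙 _ := by
  have := G.isExact.isIso_toCosyzygyZero
  obtain ⟨h₀, h₁, h₂⟩ := G.isHomExact _ h
  obtain _ | n := n
  · obtain ⟨r, hr⟩ := h₀ G.toCosyzygyZero
    refine ⟨r, ?_⟩
    rw [← cancel_epi G.toCosyzygyZero, kernel.lift_ι_assoc, hr, Category.comp_id]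
  · have := epi_toCosyzygy (G.isExact.2.2 n)
    suffices H : ∃ r, G.cocomplex.d n (n + 1) ≫ r = toCosyzygy G.cocomplex n by
      obtain ⟨r, hr⟩ := H
      refine ⟨r, ?_⟩
      rw [← cancel_epi (toCosyzygy G.cocomplex n), kernel.lift_ι_assoc, hr, Category.comp_id]
    obtain _ | n := n
    · exact h₁ _ (by
        rw [← cancel_mono (kernel.ι _), Category.assoc, zero_comp]
        exact (G.ι ≫= kernel.lift_ι _ _ _).trans G.ι_comp_d)
    · exact h₂ n _ (by rw [← cancel_mono (kernel.ι _)]; simp)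

lemma subsingleton_extGWI {n : ℕ} (h : IsGorensteinWeakInjective (cosyzygy G.cocomplex n))
    (M : ModuleCat.{u} R) : Subsingleton (ExtGWI M G (n + 1)) := by
  rw [subsingleton_extGWI_iff]
  intro x hx
  obtain ⟨r, hr⟩ := G.exists_retraction h
  have hS := shortExact_cosyzygy (G.isExact.2.2 n)
  let σ := ShortComplex.Splitting.ofExactOfRetraction _ hS.exact r hr hS.epi_g
  have hσ : σ.s ≫ G.cocomplex.d n (n + 1) = kernel.ι _ := by
    simpa using σ.s_g =≫ kernel.ι _
  exact ⟨kernel.lift _ x hx ≫ σ.s, by rw [Category.assoc, hσ, kernel.lift_ι]⟩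

end ProperRightGWIResolution

end GorensteinWeak

/-! ### The equivalences. -/

open GorensteinWeak in
theorem proposition4 (R : Type u) [Ring R] (hR : leftGwiD R < ⊤) :
    (∀ N : ModuleCat.{u} R, Nonempty (ProperRightGWIResolution N)) ∧
    ∀ (N : ModuleCat.{u} R) (G : ProperRightGWIResolution N) (n : ℕ),
      List.TFAE [
        Gwid N ≤ n,
        ∀ W : ModuleCat.{u} R, IsWeakInjective W →
          ∀ i ≥ n + 1, Subsingleton (Abelian.Ext W N i),
        ∀ W : ModuleCat.{u} R, wid W < ⊤ →
          ∀ i ≥ n + 1, Subsingleton (Abelian.Ext W N i),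
        ∀ C : CoaugmentedComplex N, C.IsExactOfLength n →
          (∀ i < n, Injective (C.cocomplex.X i)) →
            IsGorensteinWeakInjective (C.cocomplex.X n),
        ∀ C : CoaugmentedComplex N, C.IsExactOfLength n →
          (∀ i < n, IsGorensteinWeakInjective (C.cocomplex.X i)) →
            IsGorensteinWeakInjective (C.cocomplex.X n),
        ∀ M : ModuleCat.{u} R, Subsingleton (ExtGWI M G (n + 1)),
        ∀ M : ModuleCat.{u} R, ∀ i ≥ n + 1, Subsingleton (ExtGWI M G i)] := by
  have hA := hasGWIApproximation_of_leftGwiD_lt_top hR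
  refine ⟨nonempty_properRightGWIResolution hA, fun N G n => ?_⟩
  have hG : ∀ n, ExtVanishesAbove n N ↔ ExtVanishesAbove 0 (cosyzygy G.cocomplex n) := fun n =>
    G.isExact.extVanishesAbove_iff fun i _ => G.gorensteinWeakInjective i
  tfae_have 1 → 2 := fun h => by
    obtain ⟨m, hm, C, hC, hX⟩ := exists_of_Gwid_le h
    have := hC.isIso_kernelι
    exact ((hC.1.extVanishesAbove_iff fun i hi => hX i hi.le).2
      (((hX m le_rfl).extVanishesAbove 0).of_iso (asIso (kernel.ι _)))).mono hm
  tfae_have 2 → 5 := fun h C hC hX => by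
    have := hC.isIso_kernelι
    exact (((hC.1.extVanishesAbove_iff hX).1 h).isGorensteinWeakInjective hA).of_iso
      (asIso (kernel.ι (C.cocomplex.d n (n + 1)))).symm
  tfae_have 5 → 4 := fun h C hC hX => h C hC fun i hi => have := hX i hi; .of_injective _
  -- A truncated injective resolution is the required coresolution; the hypothesis handles its last
  -- term.
  tfae_have 4 → 1 := fun h => by
    obtain ⟨C, hC, hX⟩ := exists_isExactOfLength_injective N n
    refine sInf_le ⟨n, rfl, C, hC, fun i hi => ?_⟩
    obtain hi | rfl := hi.lt_or_eq
    · have := hX i hi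
      exact .of_injective _
    · exact h C hC hX
  tfae_have 2 → 3 := fun h W hW i hi =>
    (HasFiniteWeakInjectiveCoresolution.of_wid_lt_top hW).subsingleton_ext h i hi
  tfae_have 3 → 2 := fun h W hW => h W hW.wid_lt_top
  tfae_have 2 → 7 := fun h M i hi => by
    obtain ⟨i, rfl⟩ : ∃ j, i = j + 1 := ⟨i - 1, by omega⟩
    have hi := (hG i).1 (ExtVanishesAbove.mono (by omega) h)
    exact G.subsingleton_extGWI (hi.isGorensteinWeakInjective hA) M
  tfae_have 7 → 6 := fun h M => h M (n + 1) le_rfl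
  tfae_have 6 → 2 := fun h => (hG n).2 (G.extVanishesAbove_cosyzygy h)
  tfae_finish
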